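/- **Model.** Consider a synchronous complete network of $n$ nodes in the $KT_0$ model: each node has $n-1$ ports, joined by a bijection to the $n-1$ other nodes, and does not know which port leads to which node; a message received through a port comes from the node to which this port leads. All nodes know $n$ and run the same randomized algorithm. In each round a node may send one bit string (a message) through each of its ports, as a function of its input bit, its private fair random bits tossed so far (as many as it wants in every round; there is no common coin), the messages it received through each port in earlier rounds and, in the non-anonymous setting, its own identifier. In the *anonymous* setting nodes have no identifiers. In the *non-anonymous* setting the nodes have distinct identifiers in $\{1,\dots,n^k\}$, each initially known only to its owner, and Byzantine nodes can fake identifiers (no identifier is authentically attached to messages). A computationally unbounded adversary controls exactly $\epsilon n$ nodes (the Byzantine nodes; $\epsilon n$ is assumed to be an integer). Before the start it chooses which nodes are Byzantine, the port assignments, the input bits and, in the non-anonymous setting, the identifiers. In each round it chooses the messages of the Byzantine nodes, knowing the states and all random bits so far of all nodes and the messages that good nodes send in this round, but not future random bits. It is *admissible for budget $B$* if the Byzantine nodes send at most $B$ messages in total in every execution. An algorithm $\mathcal A$ *solves Byzantine agreement with budget $B$* if, against every adversary admissible for budget $B$, with probability $1$ all good nodes decide on the same bit and this bit is the input of some good node.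 Its *message complexity* $M_{\mathcal A}$ is the supremum, over all adversaries admissible for budget $B$, of the expected total number of messages sent by good nodes. **Theorem.** Let $\epsilon\in(0,1)$ and $\alpha\in(0,1]$. There are $c>0$ and $n_0$, depending only on $\epsilon$ and $\alpha$, such that for every $n\ge n_0$ with $\epsilon n$ an integer: 1. every algorithm $\mathcal A$ for $n$ nodes that solves Byzantine agreement with budget $B=n^{1+\alpha}$ in the anonymous $KT_0$ setting satisfies $M_{\mathcal A}\ge c\,n^{1+\alpha/2}$; 2. for every integer $k\ge 1$, the same bound holds for every algorithm $\mathcal A$ for $n$ nodes that solves Byzantine agreement with budget $B=n^{1+\alpha}$ in the non-anonymous $KT_0$ setting with identifiers in $\{1,\dots,n^k\}$, where Byzantine nodes can fake identifiers. -/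

import Mathlib

open MeasureTheory

noncomputable section

/-- Messages are arbitrary finite bit strings. -/
abbrev Msg : Type := List Bool

/-- One private random string: infinitely many bits, of which a node uses as many as it needs. -/
abbrev BitString : Type := ℕ → Bool

/-- The fair distribution on one bit. -/
def fairBit : Measure Bool := (PMF.uniformOfFintype Bool).toMeasure

instance : IsProbabilityMeasure fairBit := by
  unfold fairBit; infer_instance

/-- Independent fair bits: the coins a node tosses in one round. -/
def roundCoins : Measure BitString := Measure.infinitePi fun _ : ℕ => fairBit

instance : IsProbabilityMeasure roundCoins := by
  unfold roundCoins; infer_instance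

/-- The coins of one node: a fresh string in every round. -/
def nodeCoins : Measure (ℕ → BitString) := Measure.infinitePi fun _ : ℕ => roundCoins

instance : IsProbabilityMeasure nodeCoins := by
  unfold nodeCoins; infer_instance

/-- All coins `ω v r i` (node `v`, round `r`, `i`-th bit); there is no common coin. -/
abbrev Coins (n : ℕ) : Type := Fin n → ℕ → BitString

/-- All bits of all nodes are fair and mutually independent. -/
def coinMeasure (n : ℕ) : Measure (Coins n) := Measure.pi fun _ : Fin n => nodeCoins

instance (n : ℕ) : IsProbabilityMeasure (coinMeasure n) := by
  unfold coinMeasure; infer_instance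

/-- Everything a node knows when it acts in round `r`: its label (`Unit` in the anonymous setting,
its identifier otherwise), its input bit, the coins it tossed in rounds `0, …, r`, and what arrived
through each of its `n - 1` ports in rounds `0, …, r - 1` (`none` means no message). It does not
know to which node a port leads. -/
structure LocalView (n : ℕ) (L : Type) (r : ℕ) where
  label : L
  input : Bool
  coins : Fin (r + 1) → BitString
  received : Fin r → Fin (n - 1) → Option Msg

/-- A randomized synchronous algorithm for `n` nodes. Every node runs the same code: in round `r` it
sends through port `p` the message `send r view p` (nothing if this is `none`), and it announces the
output `output r view` (`none` as long as it is undecided). The two last fields say that the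
code is a measurable function of the coins. -/
structure Algorithm (n : ℕ) (L : Type) where
  send : (r : ℕ) → LocalView n L r → Fin (n - 1) → Option Msg
  output : (r : ℕ) → LocalView n L r → Option Bool
  measurable_send : ∀ (r : ℕ) (l : L) (b : Bool) (h : Fin r → Fin (n - 1) → Option Msg)
    (p : Fin (n - 1)) (m : Option Msg), MeasurableSet {c | send r ⟨l, b, c, h⟩ p = m}
  measurable_output : ∀ (r : ℕ) (l : L) (b : Bool) (h : Fin r → Fin (n - 1) → Option Msg)
    (o : Option Bool), MeasurableSet {c | output r ⟨l, b, c, h⟩ = o}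

/-- A strategy of the static, rushing, full-information, computationally unbounded adversary. Before
the start it chooses the Byzantine nodes, the wiring of the ports of every node to the other nodes,
the labels and the input bits. In round `r` the Byzantine node `v` sends `behave r c v p` through
its port `p`, where `c` holds the coins of all nodes in rounds `0, …, r`. As the algorithm and the
strategy are fixed, `c` determines the states of all nodes and all messages of the good
nodes up to and including round `r`; coins of later rounds are unknown to the adversary. The coins
of Byzantine nodes may be used as randomness of the adversary. -/
structure Adversary (n : ℕ) (L : Type) where
  byz : Finset (Fin n)
  port : (v : Fin n) → Fin (n - 1) ≃ {u : Fin n // u ≠ v}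
  label : Fin n → L
  input : Fin n → Bool
  behave : (r : ℕ) → (Fin n → Fin (r + 1) → BitString) → Fin n → Fin (n - 1) → Option Msg
  measurable_behave : ∀ (r : ℕ) (v : Fin n) (p : Fin (n - 1)) (m : Option Msg),
    MeasurableSet {c | behave r c v p = m}

namespace Algorithm

variable {n : ℕ} {L : Type}

/-- The message that node `v` sends through its port `p` in round `r`. A message sent in round `s`
by `w` through the port of `w` leading to `v` is received by `v` through the port leading to `w`
and is available from round `s + 1` on. -/
def sent (A : Algorithm n L) (S : Adversary n L) (ω : Coins n) (r : ℕ) (v : Fin n)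
    (p : Fin (n - 1)) : Option Msg :=
  if v ∈ S.byz then S.behave r (fun u s => ω u s) v p
  else A.send r
    { label := S.label v
      input := S.input v
      coins := fun s => ω v s
      received := fun s q => sent A S ω s.1 (S.port v q).1
        ((S.port (S.port v q).1).symm ⟨v, (S.port v q).2.symm⟩) } p
termination_by r
decreasing_by exact s.2

/-- The view of node `v` in round `r` of the execution. -/
def view (A : Algorithm n L) (S : Adversary n L) (ω : Coins n) (r : ℕ) (v : Fin n) :
    LocalView n L r where
  label := S.label v
  input := S.input v
  coins := fun s => ω v s
  received := fun s q => A.sent S ω s.1 (S.port v q).1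
    ((S.port (S.port v q).1).symm ⟨v, (S.port v q).2.symm⟩)

/-- Node `v` decides `b`: the first output that it announces is `b`. -/
def Decides (A : Algorithm n L) (S : Adversary n L) (ω : Coins n) (v : Fin n) (b : Bool) : Prop :=
  ∃ r, A.output r (A.view S ω r v) = some b ∧ ∀ s < r, A.output s (A.view S ω s v) = none

/-- The number of messages sent by the nodes of `U` during the whole execution. -/
def messagesFrom (A : Algorithm n L) (S : Adversary n L) (ω : Coins n) (U : Finset (Fin n)) :
    ENNReal :=
  ∑' r : ℕ, ∑ v ∈ U, ∑ p : Fin (n - 1), if (A.sent S ω r v p).isSome then 1 else 0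

/-- The adversary controls exactly `t` nodes, uses a labelling from `Λ`, and its nodes never send
more than `B` messages in total. -/
def Admissible (A : Algorithm n L) (Λ : Set (Fin n → L)) (t : ℕ) (B : ℝ) (S : Adversary n L) :
    Prop :=
  S.byz.card = t ∧ S.label ∈ Λ ∧ ∀ ω, A.messagesFrom S ω S.byz ≤ ENNReal.ofReal B

/-- Everywhere Byzantine agreement with success probability one against every admissible adversary:
all good nodes decide on a common bit, and this bit is the input of some good node. -/
def SolvesBA (A : Algorithm n L) (Λ : Set (Fin n → L)) (t : ℕ) (B : ℝ) : Prop :=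
  ∀ S : Adversary n L, A.Admissible Λ t B S → ∀ᵐ ω ∂coinMeasure n,
    ∃ b : Bool, (∃ u, u ∉ S.byz ∧ S.input u = b) ∧ ∀ v, v ∉ S.byz → A.Decides S ω v b

/-- Message complexity: the largest expected number of messages sent by good nodes, over all
admissible adversaries. -/
def messageComplexity (A : Algorithm n L) (Λ : Set (Fin n → L)) (t : ℕ) (B : ℝ) : ENNReal :=
  ⨆ S : Adversary n L, ⨆ _ : A.Admissible Λ t B S,
    ∫⁻ ω, A.messagesFrom S ω (S.byz)ᶜ ∂coinMeasure n

end Algorithm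

/-- Anonymous nodes: the label carries no information. -/
def anonymous (n : ℕ) : Set (Fin n → Unit) := Set.univ

/-- Distinct identifiers in `{1, …, n ^ k}`. They are known only to their owners, and nothing ties
the content of a message of a Byzantine node to the identifier of that node, so Byzantine nodes
can fake identifiers. -/
def distinctIDs (n k : ℕ) : Set (Fin n → ℕ) :=
  {ids | Function.Injective ids ∧ ∀ v, ids v ∈ Set.Icc 1 (n ^ k)}

end

/-! Suppose good nodes send few messages: n·M < (n - t)·K with K = ε n^(1+α)/4. The script of a
fault-free execution can be followed by any t Byzantine nodes as long as the budget lasts. Averaging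
over all t-sets, fault-free executions with constant inputs send at most K messages with positive
probability (`measure_light_pos`), and by validity and indistinguishability they then decide their
common input (`ae_decides_faultFree`).

There are finitely many sets of links, so for each of the two constant inputs some fixed set of at
most K links carries all traffic with positive probability. The two sets together are so sparse that
some node v has all its contacts in a set of t other nodes (`exists_card_eq_contacts_subset`).
Corrupting that set isolates v: the Byzantine nodes show v the all-true execution and everyone else
the all-false one, at a cost of at most 2K messages (`view_split`). Exchanging the coins of v
between two independent executions shows that both illusions succeed at once with positive
probability (`exists_frequently_exchange`). Then v decides true and another good node decides false,
a contradiction. The argument in fact yields order n^(1+α). -/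

noncomputable section

/-! ### Transcripts and truncation to a message budget. -/

/-- The number of messages that the nodes of `U` send in round `r` of the transcript `f`. -/
def load {n : ℕ} (f : ℕ → Fin n → Fin (n - 1) → Option Msg) (U : Finset (Fin n)) (r : ℕ) :
    ENNReal :=
  ∑ v ∈ U, ∑ p : Fin (n - 1), if (f r v p).isSome then 1 else 0

/-- The transcript `f`, silenced from the first round on in which the nodes of `U` would exceed the
budget `B`. -/
def throttle {n : ℕ} (U : Finset (Fin n)) (B : ENNReal)
    (f : ℕ → Fin n → Fin (n - 1) → Option Msg) : ℕ → Fin n → Fin (n - 1) → Option Msg :=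
  open Classical in
  fun r v p => if ∑ s ∈ Finset.range (r + 1), load f U s ≤ B then f r v p else none

/-- Coins of the first rounds, continued arbitrarily. -/
def extendCoins {n : ℕ} (r : ℕ) (c : Fin n → Fin (r + 1) → BitString) : Coins n :=
  fun u s => c u ⟨min s r, by omega⟩

/-- The coins agree in the rounds `0, …, r`. -/
def AgreeUpTo {n : ℕ} (r : ℕ) (ω ω' : Coins n) : Prop :=
  ∀ u, ∀ s ≤ r, ω u s = ω' u s

section Transcripts

variable {n : ℕ}

theorem load_mono_set (f : ℕ → Fin n → Fin (n - 1) → Option Msg) {U V : Finset (Fin n)}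
    (h : U ⊆ V) (r : ℕ) : load f U r ≤ load f V r :=
  Finset.sum_le_sum_of_subset h

theorem load_le_of_isSome {f g : ℕ → Fin n → Fin (n - 1) → Option Msg} {r : ℕ}
    (h : ∀ v p, (f r v p).isSome → (g r v p).isSome) (U : Finset (Fin n)) :
    load f U r ≤ load g U r := by
  unfold load
  gcongr with v _ p _
  by_cases hf : (f r v p).isSome
  · simp [hf, h v p hf]
  · simp [hf]

theorem load_congr {f g : ℕ → Fin n → Fin (n - 1) → Option Msg} {r : ℕ} {U : Finset (Fin n)}
    (h : ∀ v ∈ U, ∀ p, f r v p = g r v p) : load f U r = load g U r := by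
  unfold load
  refine Finset.sum_congr rfl fun v hv => Finset.sum_congr rfl fun p _ => ?_
  rw [h v hv p]

theorem throttle_eq_of_le {U : Finset (Fin n)} {B : ENNReal}
    {f : ℕ → Fin n → Fin (n - 1) → Option Msg} {r : ℕ}
    (h : ∑ s ∈ Finset.range (r + 1), load f U s ≤ B) (v : Fin n) (p : Fin (n - 1)) :
    throttle U B f r v p = f r v p := by
  simp [throttle, h]

theorem throttle_eq_of_tsum_le {U : Finset (Fin n)} {B : ENNReal}
    {f : ℕ → Fin n → Fin (n - 1) → Option Msg} (h : ∑' s, load f U s ≤ B) (r : ℕ) (v : Fin n)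
    (p : Fin (n - 1)) : throttle U B f r v p = f r v p :=
  throttle_eq_of_le ((ENNReal.sum_le_tsum _).trans h) v p

theorem throttle_congr {U : Finset (Fin n)} {B : ENNReal}
    {f g : ℕ → Fin n → Fin (n - 1) → Option Msg} {r : ℕ}
    (h : ∀ s ≤ r, ∀ v p, f s v p = g s v p) (v : Fin n) (p : Fin (n - 1)) :
    throttle U B f r v p = throttle U B g r v p := by
  have : ∑ s ∈ Finset.range (r + 1), load f U s = ∑ s ∈ Finset.range (r + 1), load g U s :=
    Finset.sum_congr rfl fun s hs =>
      load_congr fun v _ p => h s (by simpa [Nat.lt_succ_iff] using hs) v p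
  simp only [throttle, this, h r le_rfl v p]

/-- As long as the raw prefix fits the budget, the throttled prefix is dominated by it; a round in
which it no longer fits contributes nothing. -/
theorem tsum_load_throttle_le (U : Finset (Fin n)) (B : ENNReal)
    (f : ℕ → Fin n → Fin (n - 1) → Option Msg) : ∑' r, load (throttle U B f) U r ≤ B := by
  rw [ENNReal.tsum_eq_iSup_nat]
  refine iSup_le fun N => ?_
  induction N with
  | zero => simp
  | succ N ih =>
    by_cases h : ∑ s ∈ Finset.range (N + 1), load f U s ≤ B
    · refine le_trans (Finset.sum_le_sum fun s _ => load_le_of_isSome (fun v p hs => ?_) U) h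
      unfold throttle at hs
      split_ifs at hs with h'
      · exact hs
      · simp at hs
    · rw [Finset.sum_range_succ]
      have : load (throttle U B f) U N = 0 := by
        unfold load throttle
        simp only [if_neg h]
        simp
      rwa [this, add_zero]

theorem AgreeUpTo.mono {r s : ℕ} {ω ω' : Coins n} (h : AgreeUpTo r ω ω') (hs : s ≤ r) :
    AgreeUpTo s ω ω' := fun u i hi => h u i (hi.trans hs)

theorem agreeUpTo_extendCoins (r : ℕ) (ω : Coins n) :
    AgreeUpTo r (extendCoins r fun u s => ω u s) ω := by
  intro u s hs
  simp [extendCoins, hs]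

theorem measurable_extendCoins (r : ℕ) : Measurable (extendCoins (n := n) r) := by
  unfold extendCoins
  fun_prop

theorem measurable_load {Ω : Type*} [MeasurableSpace Ω]
    {f : Ω → ℕ → Fin n → Fin (n - 1) → Option Msg}
    (hf : ∀ r v p m, MeasurableSet {ω | f ω r v p = m}) (U : Finset (Fin n)) (r : ℕ) :
    Measurable fun ω => load (f ω) U r := by
  unfold load
  refine Finset.measurable_sum _ fun v _ => Finset.measurable_sum _ fun p _ => ?_
  refine Measurable.ite ?_ measurable_const measurable_const
  have : {ω | (f ω r v p).isSome = true} = {ω | f ω r v p = none}ᶜ := by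
    ext ω; simp [Option.isSome_iff_ne_none]
  rw [this]
  exact (hf r v p none).compl

theorem measurableSet_throttle {Ω : Type*} [MeasurableSpace Ω]
    {f : Ω → ℕ → Fin n → Fin (n - 1) → Option Msg}
    (hf : ∀ r v p m, MeasurableSet {ω | f ω r v p = m}) (U : Finset (Fin n)) (B : ENNReal)
    (r : ℕ) (v : Fin n) (p : Fin (n - 1)) (m : Option Msg) :
    MeasurableSet {ω | throttle U B (f ω) r v p = m} := by
  have hle : MeasurableSet {ω | ∑ s ∈ Finset.range (r + 1), load (f ω) U s ≤ B} :=
    measurableSet_le (Finset.measurable_sum _ fun s _ => measurable_load hf U s) measurable_const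
  have : {ω | throttle U B (f ω) r v p = m} =
      ({ω | ∑ s ∈ Finset.range (r + 1), load (f ω) U s ≤ B} ∩ {ω | f ω r v p = m}) ∪
      ({ω | ∑ s ∈ Finset.range (r + 1), load (f ω) U s ≤ B}ᶜ ∩ {_ω | none = m}) := by
    ext ω
    simp only [throttle, Set.mem_ofPred_eq, Set.mem_union, Set.mem_inter_iff, Set.mem_compl_iff]
    split_ifs with h <;> simp [h]
  rw [this]
  exact (hle.inter (hf r v p m)).union (hle.compl.inter (MeasurableSet.const _))

end Transcripts

/-! ### Scripted adversaries, causality and measurability of executions. -/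

/-- The Byzantine nodes follow the script `raw`, a transcript that depends on the coins, until they
would exceed the budget `B`. -/
def scripted {n : ℕ} {L : Type} (byz : Finset (Fin n))
    (port : (v : Fin n) → Fin (n - 1) ≃ {u : Fin n // u ≠ v}) (label : Fin n → L)
    (input : Fin n → Bool) (B : ENNReal) (raw : Coins n → ℕ → Fin n → Fin (n - 1) → Option Msg)
    (hraw : ∀ r v p m, MeasurableSet {ω | raw ω r v p = m}) : Adversary n L where
  byz := byz
  port := port
  label := label
  input := input
  behave r c v p := throttle byz B (raw (extendCoins r c)) r v p
  measurable_behave r v p m :=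
    measurable_extendCoins r (measurableSet_throttle hraw byz B r v p m)

/-- No node is Byzantine. -/
def faultFree {n : ℕ} {L : Type} (port : (v : Fin n) → Fin (n - 1) ≃ {u : Fin n // u ≠ v})
    (label : Fin n → L) (input : Fin n → Bool) : Adversary n L where
  byz := ∅
  port := port
  label := label
  input := input
  behave _ _ _ _ := none
  measurable_behave _ _ _ _ := MeasurableSet.const _

/-- The port of `w` that leads to `v`, where `w` is the node behind the port `q` of `v`. -/
def Adversary.backPort {n : ℕ} {L : Type} (S : Adversary n L) (v : Fin n) (q : Fin (n - 1)) :
    Fin (n - 1) :=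
  (S.port (S.port v q).1).symm ⟨v, (S.port v q).2.symm⟩

theorem Adversary.port_backPort {n : ℕ} {L : Type} (S : Adversary n L) (v : Fin n)
    (q : Fin (n - 1)) : (S.port (S.port v q).1 (S.backPort v q)).1 = v := by
  simp [Adversary.backPort]

namespace Algorithm

variable {n : ℕ} {L : Type}

theorem messagesFrom_eq_tsum_load (A : Algorithm n L) (S : Adversary n L) (ω : Coins n)
    (U : Finset (Fin n)) : A.messagesFrom S ω U = ∑' r, load (A.sent S ω) U r := rfl

theorem sent_of_mem (A : Algorithm n L) (S : Adversary n L) (ω : Coins n) (r : ℕ) {v : Fin n}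
    (hv : v ∈ S.byz) (p : Fin (n - 1)) :
    A.sent S ω r v p = S.behave r (fun u s => ω u s) v p := by
  rw [sent, if_pos hv]

theorem sent_of_notMem (A : Algorithm n L) (S : Adversary n L) (ω : Coins n) (r : ℕ) {v : Fin n}
    (hv : v ∉ S.byz) (p : Fin (n - 1)) : A.sent S ω r v p = A.send r (A.view S ω r v) p := by
  rw [sent, if_neg hv]
  rfl

theorem view_congr (A : Algorithm n L) {S S' : Adversary n L} {ω ω' : Coins n} {r : ℕ} {v : Fin n}
    (hp : S.port = S'.port) (hl : S.label v = S'.label v) (hi : S.input v = S'.input v)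
    (hc : ∀ s ≤ r, ω v s = ω' v s)
    (hr : ∀ s < r, ∀ q, A.sent S ω s (S'.port v q).1 (S'.backPort v q) =
      A.sent S' ω' s (S'.port v q).1 (S'.backPort v q)) :
    A.view S ω r v = A.view S' ω' r v := by
  obtain ⟨_, _, _, _, _, _⟩ := S
  obtain ⟨_, _, _, _, _, _⟩ := S'
  dsimp only at hp hl hi
  subst hp
  unfold view
  congr 1
  · funext s
    exact hc s (by omega)
  · funext s q
    exact hr s.1 s.2 q

/-- Causality: this is what allows a transcript of another execution to serve as a script for an
adversary that cannot see future coins. -/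
theorem sent_congr_coins (A : Algorithm n L) (S : Adversary n L) {ω ω' : Coins n} (r : ℕ)
    (h : AgreeUpTo r ω ω') (v : Fin n) (p : Fin (n - 1)) :
    A.sent S ω r v p = A.sent S ω' r v p := by
  induction r using Nat.strong_induction_on generalizing v p with
  | _ r ih =>
    by_cases hv : v ∈ S.byz
    · rw [sent_of_mem _ _ _ _ hv, sent_of_mem _ _ _ _ hv]
      congr 1
      funext u s
      exact h u s (by omega)
    · rw [sent_of_notMem _ _ _ _ hv, sent_of_notMem _ _ _ _ hv, A.view_congr rfl rfl rfl (h v)]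
      exact fun s hs q => ih s hs (h.mono hs.le) _ _

theorem measurableSet_sent (A : Algorithm n L) (S : Adversary n L) (r : ℕ) (v : Fin n)
    (p : Fin (n - 1)) (m : Option Msg) : MeasurableSet {ω | A.sent S ω r v p = m} := by
  induction r using Nat.strong_induction_on generalizing v p m with
  | _ r ih =>
    by_cases hv : v ∈ S.byz
    · simp_rw [sent_of_mem _ _ _ _ hv]
      have : Measurable fun (ω : Coins n) (u : Fin n) (s : Fin (r + 1)) => ω u s := by fun_prop
      exact this (S.measurable_behave r v p m)
    · simp_rw [sent_of_notMem _ _ _ _ hv]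
      have hcoins : Measurable fun (ω : Coins n) (s : Fin (r + 1)) => ω v s := by fun_prop
      -- Measurability of `send` is given only for a fixed history; since messages are finite
      -- strings, there are countably many histories to split over.
      have : {ω | A.send r (A.view S ω r v) p = m} =
          ⋃ h : Fin r → Fin (n - 1) → Option Msg,
            {ω | (A.view S ω r v).received = h} ∩
            {ω | A.send r ⟨S.label v, S.input v, fun s => ω v s, h⟩ p = m} := by
        ext ω
        simp only [Set.mem_ofPred_eq, Set.mem_iUnion, Set.mem_inter_iff, exists_eq_left']
        rfl
      rw [this]
      refine MeasurableSet.iUnion fun h => MeasurableSet.inter ?_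
        (hcoins (A.measurable_send r _ _ h p m))
      have : {ω | (A.view S ω r v).received = h} =
          ⋂ s, ⋂ q, {ω | A.sent S ω s.1 (S.port v q).1 (S.backPort v q) = h s q} := by
        ext ω
        simp only [Set.mem_ofPred_eq, Set.mem_iInter, funext_iff]
        rfl
      rw [this]
      exact MeasurableSet.iInter fun s => MeasurableSet.iInter fun q => ih s.1 s.2 _ _ _

theorem measurable_messagesFrom (A : Algorithm n L) (S : Adversary n L) (U : Finset (Fin n)) :
    Measurable fun ω => A.messagesFrom S ω U :=
  Measurable.tsum fun r => measurable_load (A.measurableSet_sent S) U r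

/-- For an adapted script, the arbitrary continuation in `extendCoins` is harmless: throttling in
round r reads only rounds up to r. -/
theorem sent_scripted (A : Algorithm n L) {byz : Finset (Fin n)}
    {port : (v : Fin n) → Fin (n - 1) ≃ {u : Fin n // u ≠ v}} {label : Fin n → L}
    {input : Fin n → Bool} {B : ENNReal} {raw : Coins n → ℕ → Fin n → Fin (n - 1) → Option Msg}
    {hraw : ∀ r v p m, MeasurableSet {ω | raw ω r v p = m}}
    (hadapted : ∀ r ω ω', AgreeUpTo r ω ω' → ∀ v p, raw ω r v p = raw ω' r v p)
    (ω : Coins n) (r : ℕ) {v : Fin n} (hv : v ∈ byz) (p : Fin (n - 1)) :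
    A.sent (scripted byz port label input B raw hraw) ω r v p =
      throttle byz B (raw ω) r v p := by
  rw [sent_of_mem _ _ _ _ hv]
  exact throttle_congr
    (fun s hs v p => hadapted s _ _ ((agreeUpTo_extendCoins r ω).mono hs) v p) v p

theorem admissible_scripted (A : Algorithm n L) {Λ : Set (Fin n → L)} {B : ℝ}
    {byz : Finset (Fin n)} {port : (v : Fin n) → Fin (n - 1) ≃ {u : Fin n // u ≠ v}}
    {label : Fin n → L} (hlabel : label ∈ Λ) {input : Fin n → Bool}
    {raw : Coins n → ℕ → Fin n → Fin (n - 1) → Option Msg}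
    {hraw : ∀ r v p m, MeasurableSet {ω | raw ω r v p = m}}
    (hadapted : ∀ r ω ω', AgreeUpTo r ω ω' → ∀ v p, raw ω r v p = raw ω' r v p) :
    A.Admissible Λ byz.card B (scripted byz port label input (ENNReal.ofReal B) raw hraw) := by
  refine ⟨rfl, hlabel, fun ω => ?_⟩
  rw [messagesFrom_eq_tsum_load]
  refine le_trans (le_of_eq (tsum_congr fun r => load_congr fun v hv p => ?_))
    (tsum_load_throttle_le byz (ENNReal.ofReal B) (raw ω))
  exact A.sent_scripted hadapted ω r hv p

theorem Decides.unique {A : Algorithm n L} {S : Adversary n L} {ω : Coins n} {v : Fin n}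
    {b b' : Bool} (h : A.Decides S ω v b) (h' : A.Decides S ω v b') : b = b' := by
  obtain ⟨r, hr, hlt⟩ := h
  obtain ⟨r', hr', hlt'⟩ := h'
  rcases lt_trichotomy r r' with hlt'' | rfl | hlt''
  · simp [hlt' r hlt''] at hr
  · simpa [hr] using hr'
  · simp [hlt r' hlt''] at hr'

theorem Decides.congr {A : Algorithm n L} {S S' : Adversary n L} {ω ω' : Coins n} {v : Fin n}
    {b : Bool} (h : A.Decides S ω v b) (hview : ∀ r, A.view S ω r v = A.view S' ω' r v) :
    A.Decides S' ω' v b := by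
  obtain ⟨r, hr, hlt⟩ := h
  exact ⟨r, by rw [← hview, hr], fun s hs => by rw [← hview, hlt s hs]⟩

end Algorithm

/-! ### Fault-free executions are light with positive probability. -/

theorem sum_powersetCard_sum_compl {n : ℕ} (t : ℕ) (f : Fin n → ENNReal) :
    ∑ S ∈ Finset.powersetCard t (Finset.univ : Finset (Fin n)), ∑ v ∈ Sᶜ, f v =
      (n - 1).choose t * ∑ v, f v := by
  rw [Finset.sum_comm' (t' := Finset.univ)
    (s' := fun v => Finset.powersetCard t (Finset.univ.erase v))]
  · simp [Finset.card_powersetCard, Finset.card_erase_of_mem, Finset.mul_sum]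
  · intro S v
    simp [Finset.mem_powersetCard, Finset.subset_erase, and_comm]

namespace Algorithm

variable {n : ℕ} {L : Type}

/-- The Byzantine nodes follow the fault-free execution within the budget `B`. -/
def mimic (A : Algorithm n L) (port : (v : Fin n) → Fin (n - 1) ≃ {u : Fin n // u ≠ v})
    (label : Fin n → L) (input : Fin n → Bool) (B : ENNReal) (byz : Finset (Fin n)) :
    Adversary n L :=
  scripted byz port label input B (fun ω => A.sent (faultFree port label input) ω)
    (A.measurableSet_sent _)

section FaultFree

variable (A : Algorithm n L) {port : (v : Fin n) → Fin (n - 1) ≃ {u : Fin n // u ≠ v}}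
  {label : Fin n → L} {input : Fin n → Bool}

theorem sent_mimic_of_mem {B : ENNReal} {byz : Finset (Fin n)} (ω : Coins n) (r : ℕ) {v : Fin n}
    (hv : v ∈ byz) (p : Fin (n - 1)) :
    A.sent (A.mimic port label input B byz) ω r v p =
      throttle byz B (A.sent (faultFree port label input) ω) r v p :=
  A.sent_scripted (raw := fun ω => A.sent (faultFree port label input) ω)
    (fun r _ _ ha _ _ => A.sent_congr_coins _ r ha _ _) ω r hv p

/-- A view in round r depends only on messages of rounds before r, so the budget has to last only
through round r - 1. -/
theorem view_mimic {B : ENNReal} {byz : Finset (Fin n)} {ω : Coins n} {r : ℕ}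
    (h : ∀ s < r, ∑ i ∈ Finset.range (s + 1),
      load (A.sent (faultFree port label input) ω) byz i ≤ B) {v : Fin n} :
    A.view (A.mimic port label input B byz) ω r v =
      A.view (faultFree port label input) ω r v := by
  induction r using Nat.strong_induction_on generalizing v with
  | _ r ih =>
    refine A.view_congr rfl rfl rfl (fun _ _ => rfl) fun s hs q => ?_
    by_cases hw : ((faultFree port label input).port v q).1 ∈ byz
    · rw [A.sent_mimic_of_mem ω s hw, throttle_eq_of_le (h s hs)]
    · rw [sent_of_notMem _ _ _ _ hw, sent_of_notMem _ _ _ _ (by simp [faultFree]),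
        ih s hs fun i hi => h i (hi.trans hs)]

/-- Up to and including the round in which the total first exceeds K, good nodes act as in the
fault-free execution whatever the Byzantine set is. Each node is good for `(n - 1).choose t` of the
sets. -/
theorem sum_messagesFrom_mimic_ge {B K : ENNReal} (hK : K ≤ B) (t : ℕ) {ω : Coins n}
    (h : K < A.messagesFrom (faultFree port label input) ω Finset.univ) :
    (n - 1).choose t * K ≤ ∑ S ∈ Finset.powersetCard t (Finset.univ : Finset (Fin n)),
      A.messagesFrom (A.mimic port label input B S) ω Sᶜ := by
  set f := A.sent (faultFree port label input) ω with hf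
  rw [messagesFrom_eq_tsum_load, ENNReal.tsum_eq_iSup_nat, lt_iSup_iff] at h
  classical
  -- Rounds 0, …, N - 1 together exceed K. The overshooting round N - 1 still counts, since views in
  -- it depend on earlier rounds only.
  let N := Nat.find h
  have hN : K < ∑ r ∈ Finset.range N, load f Finset.univ r := Nat.find_spec h
  have hmin : ∀ m < N, ∑ r ∈ Finset.range m, load f Finset.univ r ≤ K := fun m hm =>
    not_lt.1 (Nat.find_min h hm)
  have hS : ∀ S : Finset (Fin n), ∑ r ∈ Finset.range N, load f Sᶜ r ≤
      A.messagesFrom (A.mimic port label input B S) ω Sᶜ := by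
    intro S
    rw [messagesFrom_eq_tsum_load]
    refine le_trans (le_of_eq (Finset.sum_congr rfl fun r hr => load_congr fun v hv p => ?_))
      (ENNReal.sum_le_tsum (Finset.range N))
    rw [hf, sent_of_notMem _ _ _ _ (by simp [faultFree]),
      sent_of_notMem _ _ _ _ (by simpa [mimic, scripted] using hv), view_mimic]
    intro s hs
    refine le_trans (Finset.sum_le_sum fun i _ => load_mono_set f (Finset.subset_univ S) i) ?_
    exact (hmin (s + 1) (by have := Finset.mem_range.1 hr; omega)).trans hK
  calc (n - 1).choose t * K
      ≤ (n - 1).choose t * ∑ r ∈ Finset.range N, load f Finset.univ r := by gcongr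
    _ = ∑ S ∈ Finset.powersetCard t (Finset.univ : Finset (Fin n)),
          ∑ r ∈ Finset.range N, load f Sᶜ r := by
        rw [Finset.sum_comm, Finset.mul_sum]
        exact Finset.sum_congr rfl fun r _ => (sum_powersetCard_sum_compl t _).symm
    _ ≤ _ := Finset.sum_le_sum fun S _ => hS S

variable {Λ : Set (Fin n → L)}

theorem admissible_mimic (hlabel : label ∈ Λ) (B : ℝ) (byz : Finset (Fin n)) :
    A.Admissible Λ byz.card B (A.mimic port label input (ENNReal.ofReal B) byz) :=
  A.admissible_scripted hlabel fun r _ _ ha _ _ => A.sent_congr_coins _ r ha _ _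

/-- Otherwise the preceding bound holds almost surely; integrated, it makes the average over all
t-sets of the expected cost at least (n - t)K/n, above the message complexity. -/
theorem measure_light_pos (hlabel : label ∈ Λ) {t : ℕ} (ht : t < n) {B : ℝ} {K : ENNReal}
    (hK : K ≤ ENNReal.ofReal B)
    (hM : n * A.messageComplexity Λ t B < (n - t : ℕ) * K) :
    0 < coinMeasure n
      {ω | A.messagesFrom (faultFree port label input) ω Finset.univ ≤ K} := by
  rw [pos_iff_ne_zero]
  intro h0
  have hae : ∀ᵐ ω ∂coinMeasure n, (n - 1).choose t * K ≤
      ∑ S ∈ Finset.powersetCard t (Finset.univ : Finset (Fin n)),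
        A.messagesFrom (A.mimic port label input (ENNReal.ofReal B) S) ω Sᶜ := by
    have : ∀ᵐ ω ∂coinMeasure n,
        ¬ A.messagesFrom (faultFree port label input) ω Finset.univ ≤ K :=
      measure_eq_zero_iff_ae_notMem.1 h0
    filter_upwards [this] with ω hω
    exact A.sum_messagesFrom_mimic_ge hK t (not_le.1 hω)
  have hint : ((n - 1).choose t : ENNReal) * K ≤ n.choose t * A.messageComplexity Λ t B :=
    calc ((n - 1).choose t : ENNReal) * K = ∫⁻ _, (n - 1).choose t * K ∂coinMeasure n := by simp
      _ ≤ _ := lintegral_mono_ae hae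
      _ = ∑ S ∈ Finset.powersetCard t (Finset.univ : Finset (Fin n)), ∫⁻ ω,
            A.messagesFrom (A.mimic port label input (ENNReal.ofReal B) S) ω Sᶜ
              ∂coinMeasure n :=
          lintegral_finsetSum _ fun S _ => A.measurable_messagesFrom _ _
      _ ≤ ∑ S ∈ Finset.powersetCard t (Finset.univ : Finset (Fin n)),
            A.messageComplexity Λ t B := by
          refine Finset.sum_le_sum fun S hS => ?_
          have hadm := A.admissible_mimic (port := port) (input := input) hlabel B S
          rw [(Finset.mem_powersetCard.1 hS).2] at hadm
          exact le_iSup₂ (f := fun (S : Adversary n L) (_ : A.Admissible Λ t B S) =>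
            ∫⁻ ω, A.messagesFrom S ω (S.byz)ᶜ ∂coinMeasure n) _ hadm
      _ = _ := by simp
  have hchoose : (n - 1).choose t * n = n.choose t * (n - t) := by
    obtain ⟨m, rfl⟩ : ∃ m, n = m + 1 := ⟨n - 1, by omega⟩
    exact Nat.choose_mul_succ_eq m t
  have hpos : (n.choose t : ENNReal) ≠ 0 := by
    exact_mod_cast (Nat.choose_pos ht.le).ne'
  have : (n.choose t : ENNReal) * ((n - t : ℕ) * K) ≤
      n.choose t * (n * A.messageComplexity Λ t B) :=
    calc (n.choose t : ENNReal) * ((n - t : ℕ) * K)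
        = ((n.choose t * (n - t) : ℕ) : ENNReal) * K := by push_cast; ring
      _ = n * ((n - 1).choose t * K) := by rw [← hchoose]; push_cast; ring
      _ ≤ n * (n.choose t * A.messageComplexity Λ t B) := by gcongr
      _ = _ := by ring
  exact absurd ((ENNReal.mul_le_mul_iff_right hpos (ENNReal.natCast_ne_top _)).1 this)
    (not_le.2 hM)

/-- A fault-free run is not itself admissible when `byz` is nonempty, so correctness is imported
from `mimic`, which good nodes cannot distinguish from it on light runs. -/
theorem ae_decides_faultFree (hlabel : label ∈ Λ) {byz : Finset (Fin n)} {B : ℝ} {K : ENNReal}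
    (hK : K ≤ ENNReal.ofReal B) (hA : A.SolvesBA Λ byz.card B) (b : Bool) :
    ∀ᵐ ω ∂coinMeasure n,
      A.messagesFrom (faultFree port label fun _ => b) ω Finset.univ ≤ K →
      ∀ v, v ∉ byz → A.Decides (faultFree port label fun _ => b) ω v b := by
  filter_upwards [hA _ (A.admissible_mimic (port := port) (input := fun _ => b) hlabel B byz)]
    with ω hω hlight v hv
  obtain ⟨b', ⟨u, _, hb'⟩, hdec⟩ := hω
  -- Validity: all inputs equal b.
  obtain rfl : b = b' := hb'
  refine (hdec v hv).congr fun r => A.view_mimic fun s _ => ?_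
  calc _ ≤ ∑ i ∈ Finset.range (s + 1), load (A.sent (faultFree port label fun _ => b) ω)
          Finset.univ i := Finset.sum_le_sum fun i _ => load_mono_set _ (Finset.subset_univ _) i
    _ ≤ _ := ENNReal.sum_le_tsum _
    _ ≤ K := hlight
    _ ≤ _ := hK

/-! ### A fixed sparse set of links carries all traffic with positive probability. -/

/-- At most `K` messages are sent, all of them through ports in `g`. -/
def confined (A : Algorithm n L) (S : Adversary n L) (K : ENNReal)
    (g : Finset (Fin n × Fin (n - 1))) : Set (Coins n) :=
  {ω | A.messagesFrom S ω Finset.univ ≤ K ∧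
    ∀ u p r, (u, p) ∉ g → A.sent S ω r u p = none}

theorem measurableSet_confined (S : Adversary n L) (K : ENNReal)
    (g : Finset (Fin n × Fin (n - 1))) : MeasurableSet (A.confined S K g) := by
  have : A.confined S K g = {ω | A.messagesFrom S ω Finset.univ ≤ K} ∩
      ⋂ u, ⋂ p, ⋂ r, ⋂ _ : (u, p) ∉ g, {ω | A.sent S ω r u p = none} := by
    ext ω
    simp [confined]
  rw [this]
  refine (measurableSet_le (A.measurable_messagesFrom _ _) measurable_const).inter ?_
  exact MeasurableSet.iInter fun u => MeasurableSet.iInter fun p => MeasurableSet.iInter fun r =>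
    MeasurableSet.iInter fun _ => A.measurableSet_sent S r u p none

theorem exists_confined (S : Adversary n L) {K : ENNReal} {ω : Coins n}
    (h : A.messagesFrom S ω Finset.univ ≤ K) :
    ∃ g : Finset (Fin n × Fin (n - 1)), (g.card : ENNReal) ≤ K ∧ ω ∈ A.confined S K g := by
  classical
  -- The links ever used; each accounts for at least one of the at most K messages.
  let g : Finset (Fin n × Fin (n - 1)) :=
    Finset.univ.filter fun e => ∃ r, (A.sent S ω r e.1 e.2).isSome
  refine ⟨g, ?_, h, fun u p r hg => ?_⟩
  · calc (g.card : ENNReal) = ∑ e ∈ g, 1 := by simp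
      _ ≤ ∑ e ∈ g, ∑' r, if (A.sent S ω r e.1 e.2).isSome then 1 else 0 := by
          refine Finset.sum_le_sum fun e he => ?_
          obtain ⟨r, hr⟩ := (Finset.mem_filter.1 he).2
          refine le_trans ?_ (ENNReal.le_tsum r)
          simp [hr]
      _ ≤ ∑ e : Fin n × Fin (n - 1), ∑' r, if (A.sent S ω r e.1 e.2).isSome then 1 else 0 :=
          Finset.sum_le_sum_of_subset (Finset.subset_univ g)
      _ = ∑' r, ∑ e : Fin n × Fin (n - 1), if (A.sent S ω r e.1 e.2).isSome then 1 else 0 :=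
          (Summable.tsum_finsetSum fun _ _ => ENNReal.summable).symm
      _ = A.messagesFrom S ω Finset.univ := by
          unfold messagesFrom
          exact tsum_congr fun r => Fintype.sum_prod_type _
      _ ≤ K := h
  · by_contra hne
    exact hg (Finset.mem_filter.2 ⟨Finset.mem_univ _, r, Option.isSome_iff_ne_none.2 hne⟩)

theorem exists_measure_confined_pos (S : Adversary n L) {K : ENNReal}
    (h : 0 < coinMeasure n {ω | A.messagesFrom S ω Finset.univ ≤ K}) :
    ∃ g : Finset (Fin n × Fin (n - 1)), (g.card : ENNReal) ≤ K ∧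
      0 < coinMeasure n (A.confined S K g) := by
  by_contra! hg
  refine h.ne' (measure_mono_null (t := ⋃ g : Finset (Fin n × Fin (n - 1)),
    ⋃ _ : (g.card : ENNReal) ≤ K, A.confined S K g) (fun ω hω => ?_) ?_)
  · obtain ⟨g, hg', hω'⟩ := A.exists_confined S hω
    exact Set.mem_iUnion₂.2 ⟨g, hg', hω'⟩
  · exact measure_iUnion_null fun g => measure_iUnion_null fun hg' => le_antisymm (hg g hg') zero_le

end FaultFree

end Algorithm

/-! ### Exchanging the coins of one node; a node with few contacts. -/

/-- Exchanging the coins of one node between two executions preserves the distribution. -/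
theorem measurePreserving_exchange {n : ℕ} (v : Fin n) :
    MeasurePreserving
      (fun z : Coins n × Coins n => (Function.update z.1 v (z.2 v), Function.update z.2 v (z.1 v)))
      ((coinMeasure n).prod (coinMeasure n)) ((coinMeasure n).prod (coinMeasure n)) := by
  let swap : Fin n → (ℕ → BitString) × (ℕ → BitString) → (ℕ → BitString) × (ℕ → BitString) :=
    fun u => if u = v then Prod.swap else id
  have hswap : ∀ u, MeasurePreserving (swap u) (nodeCoins.prod nodeCoins)
      (nodeCoins.prod nodeCoins) := by
    intro u
    by_cases h : u = v
    · simpa [swap, h] using Measure.measurePreserving_swap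
    · simpa [swap, h] using MeasurePreserving.id _
  have hpi := measurePreserving_pi (fun _ : Fin n => nodeCoins.prod nodeCoins)
    (fun _ : Fin n => nodeCoins.prod nodeCoins) hswap
  have he := measurePreserving_arrowProdEquivProdArrow (ℕ → BitString) (ℕ → BitString) (Fin n)
    (fun _ => nodeCoins) (fun _ => nodeCoins)
  have := (he.comp hpi).comp (he.symm _)
  unfold coinMeasure
  convert this using 1
  funext z
  refine Prod.ext (funext fun u => ?_) (funext fun u => ?_) <;>
  · by_cases h : u = v
    · subst h
      simp [swap, MeasurableEquiv.arrowProdEquivProdArrow, Equiv.arrowProdEquivProdArrow]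
    · simp [swap, h, MeasurableEquiv.arrowProdEquivProdArrow, Equiv.arrowProdEquivProdArrow]

/-- If two events concern two independent executions, the coins of the second one, except those
of `v`, and the coins of `v` in the first one can be fixed in such a way that both events keep
positive probability when `v` switches the execution. -/
theorem exists_frequently_exchange {n : ℕ} (v : Fin n) {G G' : Set (Coins n)}
    (hG : MeasurableSet G) (hG' : MeasurableSet G') (hpos : 0 < coinMeasure n G)
    (hpos' : 0 < coinMeasure n G') {P P' : Coins n → Prop} (hP : ∀ᵐ ω ∂coinMeasure n, P ω)
    (hP' : ∀ᵐ ω ∂coinMeasure n, P' ω) :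
    ∃ η : Coins n, ∃ᵐ ω ∂coinMeasure n,
      (Function.update η v (ω v) ∈ G ∧ P (Function.update η v (ω v))) ∧
      (Function.update ω v (η v) ∈ G' ∧ P' (Function.update ω v (η v))) := by
  have hex := measurePreserving_exchange v
  have hPP : ∀ᵐ z ∂(coinMeasure n).prod (coinMeasure n), P z.1 ∧ P' z.2 :=
    (Measure.quasiMeasurePreserving_fst.ae hP).and (Measure.quasiMeasurePreserving_snd.ae hP')
  have hsec := Measure.ae_ae_of_ae_prod (hex.quasiMeasurePreserving.ae hPP)
  by_contra hcon
  simp only [not_exists, Filter.not_frequently] at hcon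
  have hmeas : MeasurableSet (G ×ˢ G') := hG.prod hG'
  -- The exchange pulls G × G' back to an event of the same measure. If every section in η were
  -- null, Fubini would make this measure 0, but it is a product of two positive numbers.
  have hnull : (coinMeasure n).prod (coinMeasure n) (G ×ˢ G') = 0 := by
    rw [← hex.measure_preimage hmeas.nullMeasurableSet,
      Measure.measure_prod_null (hex.measurable hmeas)]
    filter_upwards [hsec] with η hη
    refine measure_eq_zero_iff_ae_notMem.2 ?_
    filter_upwards [hη, hcon η] with ω hω hω' hmem
    exact hω' ⟨⟨hmem.1, hω.1⟩, hmem.2, hω.2⟩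
  rw [Measure.prod_prod, mul_eq_zero] at hnull
  exact hnull.elim hpos.ne' hpos'.ne'

/-- In a sparse set of links some node `v` has all its contacts in a set of `t` other nodes. -/
theorem exists_card_eq_contacts_subset {n : ℕ} (hn : 0 < n)
    (port : (v : Fin n) → Fin (n - 1) ≃ {u : Fin n // u ≠ v}) {t : ℕ} (ht : t < n)
    (g : Finset (Fin n × Fin (n - 1))) (hg : 2 * g.card ≤ n * t) :
    ∃ (v : Fin n) (S : Finset (Fin n)), S.card = t ∧ v ∉ S ∧ ∀ e ∈ g,
      (e.1 = v → (port e.1 e.2).1 ∈ S) ∧ ((port e.1 e.2).1 = v → e.1 ∈ S) := by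
  classical
  -- Each link is recorded in both directions, hence the factor 2 in `hg`; the average out-degree is
  -- then at most t.
  let E : Finset (Fin n × Fin n) := g.image (fun e => (e.1, (port e.1 e.2).1)) ∪
    g.image (fun e => ((port e.1 e.2).1, e.1))
  have hE : E.card ≤ (Finset.univ : Finset (Fin n)).card * t := by
    rw [Finset.card_univ, Fintype.card_fin]
    refine le_trans ((Finset.card_union_le _ _).trans ?_) hg
    rw [two_mul]
    exact add_le_add Finset.card_image_le Finset.card_image_le
  obtain ⟨v, -, hv⟩ := Finset.exists_card_fiber_le_of_card_le_mul (f := Prod.fst)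
    ⟨⟨0, hn⟩, Finset.mem_univ _⟩ hE
  let C := (E.filter fun x => x.1 = v).image Prod.snd
  have hmem : ∀ {x y}, (x, y) ∈ E → x = v → y ∈ C := fun {x y} h hx =>
    Finset.mem_image.2 ⟨(x, y), Finset.mem_filter.2 ⟨h, hx⟩, rfl⟩
  have hCv : C ⊆ Finset.univ.erase v := by
    intro y hy
    obtain ⟨⟨x, y⟩, hxy, rfl⟩ := Finset.mem_image.1 hy
    obtain ⟨hxyE, rfl⟩ := Finset.mem_filter.1 hxy
    refine Finset.mem_erase.2 ⟨?_, Finset.mem_univ _⟩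
    rcases Finset.mem_union.1 hxyE with h | h <;> obtain ⟨e, _, he⟩ := Finset.mem_image.1 h <;>
      obtain ⟨rfl, rfl⟩ := Prod.mk.inj he
    · exact (port e.1 e.2).2
    · exact (port e.1 e.2).2.symm
  obtain ⟨S, hCS, hSv, hS⟩ := Finset.exists_subsuperset_card_eq hCv
    (Finset.card_image_le.trans hv) (by simp [Finset.card_erase_of_mem]; omega)
  refine ⟨v, S, hS, fun h => by simpa using hSv h, fun e he => ⟨fun h => ?_, fun h => ?_⟩⟩
  · exact hCS (hmem (Finset.mem_union_left _ (Finset.mem_image_of_mem _ he)) h)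
  · exact hCS (hmem (Finset.mem_union_right _ (Finset.mem_image_of_mem _ he)) h)

/-! ### The splitting adversary. -/

namespace Algorithm

variable {n : ℕ} {L : Type}

section Split

variable (A : Algorithm n L) (port : (v : Fin n) → Fin (n - 1) ≃ {u : Fin n // u ≠ v})
  (label : Fin n → L)

/-- Messages to `v` are those of the fault-free execution with all inputs `true`, in which all
coins except those of `v` are given by `η`. Messages to all other nodes are those of the fault-free
execution with all inputs `false`, in which only the coins of `v` are given by `η`. -/
def splitScript (v : Fin n) (η ω : Coins n) (r : ℕ) (u : Fin n) (p : Fin (n - 1)) : Option Msg :=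
  if (port u p).1 = v then
    A.sent (faultFree port label fun _ => true) (Function.update η v (ω v)) r u p
  else A.sent (faultFree port label fun _ => false) (Function.update ω v (η v)) r u p

theorem measurableSet_splitScript (v : Fin n) (η : Coins n) (r : ℕ) (u : Fin n)
    (p : Fin (n - 1)) (m : Option Msg) :
    MeasurableSet {ω | A.splitScript port label v η ω r u p = m} := by
  have h₁ : Measurable fun ω : Coins n => Function.update η v (ω v) :=
    (measurable_update η).comp (measurable_pi_apply v)
  have h₀ : Measurable fun ω : Coins n => Function.update ω v (η v) := measurable_update_left
  unfold splitScript
  split_ifs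
  · exact h₁ (A.measurableSet_sent _ r u p m)
  · exact h₀ (A.measurableSet_sent _ r u p m)

theorem splitScript_adapted (v : Fin n) (η : Coins n) (r : ℕ) (ω ω' : Coins n)
    (h : AgreeUpTo r ω ω') (u : Fin n) (p : Fin (n - 1)) :
    A.splitScript port label v η ω r u p = A.splitScript port label v η ω' r u p := by
  unfold splitScript
  rw [A.sent_congr_coins (ω := Function.update η v (ω v)) (ω' := Function.update η v (ω' v)),
    A.sent_congr_coins (ω := Function.update ω v (η v)) (ω' := Function.update ω' v (η v))]
  all_goals
    intro w s hs
    by_cases hw : w = v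
    · subst hw; simp [h w s hs]
    · simp [hw, h w s hs]

/-- The adversary that keeps `v`, which has input `true`, in a different execution than the other
good nodes, which have input `false`. -/
def split (B : ENNReal) (byz : Finset (Fin n)) (v : Fin n) (η : Coins n) : Adversary n L :=
  scripted byz port label (fun u => decide (u = v)) B (A.splitScript port label v η)
    (A.measurableSet_splitScript port label v η)

theorem admissible_split {Λ : Set (Fin n → L)} (hlabel : label ∈ Λ) (B : ℝ)
    (byz : Finset (Fin n)) (v : Fin n) (η : Coins n) :
    A.Admissible Λ byz.card B (A.split port label (ENNReal.ofReal B) byz v η) :=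
  A.admissible_scripted hlabel (A.splitScript_adapted port label v η)

variable {port label}

/-- Every scripted message is copied from exactly one of the two executions. -/
theorem tsum_load_splitScript_le (U : Finset (Fin n)) (v : Fin n) (η ω : Coins n) :
    ∑' r, load (A.splitScript port label v η ω) U r ≤
      A.messagesFrom (faultFree port label fun _ => true) (Function.update η v (ω v))
        Finset.univ +
      A.messagesFrom (faultFree port label fun _ => false) (Function.update ω v (η v))
        Finset.univ := by
  rw [messagesFrom_eq_tsum_load, messagesFrom_eq_tsum_load, ← ENNReal.tsum_add]
  refine ENNReal.tsum_le_tsum fun r => (load_mono_set _ (Finset.subset_univ U) r).trans ?_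
  unfold load
  rw [← Finset.sum_add_distrib]
  refine Finset.sum_le_sum fun u _ => ?_
  rw [← Finset.sum_add_distrib]
  refine Finset.sum_le_sum fun p _ => ?_
  unfold splitScript
  split_ifs <;> simp

/-- Neither `v` nor the other good nodes can tell the execution from a fault-free one. -/
theorem view_split {B K : ENNReal} (hK : K + K ≤ B) {byz : Finset (Fin n)} {v : Fin n}
    (hv : v ∉ byz) {g g' : Finset (Fin n × Fin (n - 1))}
    (hg : ∀ e ∈ g ∪ g', (e.1 = v → (port e.1 e.2).1 ∈ byz) ∧ ((port e.1 e.2).1 = v → e.1 ∈ byz))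
    {η ω : Coins n}
    (h₁ : Function.update η v (ω v) ∈ A.confined (faultFree port label fun _ => true) K g)
    (h₀ : Function.update ω v (η v) ∈ A.confined (faultFree port label fun _ => false) K g')
    (r : ℕ) :
    A.view (A.split port label B byz v η) ω r v =
        A.view (faultFree port label fun _ => true) (Function.update η v (ω v)) r v ∧
      ∀ u, u ∉ byz → u ≠ v → A.view (A.split port label B byz v η) ω r u =
        A.view (faultFree port label fun _ => false) (Function.update ω v (η v)) r u := by
  have hbyz : ∀ s, ∀ w ∈ byz, ∀ p, A.sent (A.split port label B byz v η) ω s w p =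
      A.splitScript port label v η ω s w p := by
    intro s w hw p
    refine (A.sent_scripted (raw := A.splitScript port label v η)
      (A.splitScript_adapted port label v η) ω s hw p).trans (throttle_eq_of_tsum_le ?_ s w p)
    exact (A.tsum_load_splitScript_le byz v η ω).trans ((add_le_add h₁.1 h₀.1).trans hK)
  have hfrom : ∀ p, (port v p).1 ∉ byz → (v, p) ∉ g ∪ g' := fun p hp he =>
    hp ((hg _ he).1 rfl)
  have hto : ∀ w p, w ∉ byz → (port w p).1 = v → (w, p) ∉ g ∪ g' := fun w p hw hp he =>
    hw ((hg _ he).2 hp)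
  simp only [Finset.mem_union, not_or] at hfrom hto
  -- The claims for v and for the other good nodes need each other: a message crossing between them
  -- is shown to be absent by knowing which fault-free execution its sender follows.
  induction r using Nat.strong_induction_on with
  | _ r ih =>
    have hsent_v : ∀ s < r, ∀ p, A.sent (A.split port label B byz v η) ω s v p =
        A.sent (faultFree port label fun _ => true) (Function.update η v (ω v)) s v p := by
      intro s hs p
      rw [sent_of_notMem _ _ _ _ hv, sent_of_notMem _ _ _ _ (by simp [faultFree]), (ih s hs).1]
    have hsent : ∀ s < r, ∀ u, u ∉ byz → u ≠ v → ∀ p,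
        A.sent (A.split port label B byz v η) ω s u p =
        A.sent (faultFree port label fun _ => false) (Function.update ω v (η v)) s u p := by
      intro s hs u hu huv p
      rw [sent_of_notMem _ _ _ _ hu, sent_of_notMem _ _ _ _ (by simp [faultFree]),
        (ih s hs).2 u hu huv]
    constructor
    · refine A.view_congr rfl rfl (decide_eq_true rfl) (fun s _ => by simp) fun s hs q => ?_
      have hback := (faultFree port label fun _ => true).port_backPort v q
      have hne := ((faultFree port label fun _ => true).port v q).2
      generalize (faultFree port label fun _ => true).backPort v q = p at hback
      generalize ((faultFree port label fun _ => true).port v q).1 = w at *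
      replace hback : (port w p).1 = v := hback
      by_cases hw : w ∈ byz
      · rw [hbyz s w hw, splitScript, if_pos hback]
      -- A good w has no link to v in g ∪ g', so it is silent towards v both in the all-false
      -- execution it follows and in the all-true one that v should see.
      · rw [hsent s hs w hw hne, h₀.2 w p s (hto w p hw hback).2,
          h₁.2 w p s (hto w p hw hback).1]
    · intro u hu huv
      refine A.view_congr rfl rfl (decide_eq_false huv) (fun s _ => by simp [huv]) fun s hs q => ?_
      have hback := (faultFree port label fun _ => false).port_backPort u q
      generalize (faultFree port label fun _ => false).backPort u q = p at hback
      generalize ((faultFree port label fun _ => false).port u q).1 = w at *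
      replace hback : (port w p).1 = u := hback
      by_cases hw : w ∈ byz
      · rw [hbyz s w hw, splitScript, if_neg (by rw [hback]; exact huv)]
      · by_cases hwv : w = v
        · subst hwv
          have := hfrom p (by rwa [hback])
          -- Symmetrically, v is silent towards good nodes in both executions.
          rw [hsent_v s hs, h₁.2 _ p s this.1, h₀.2 _ p s this.2]
        · rw [hsent s hs w hw hwv]

end Split

/-! ### The contradiction and the choice of constants. -/

theorem sub_mul_le_mul_messageComplexity (A : Algorithm n L) {Λ : Set (Fin n → L)}
    {label : Fin n → L} (hlabel : label ∈ Λ) {t : ℕ} (ht : t + 2 ≤ n) {B : ℝ} {K : ENNReal}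
    (hK : K + K ≤ ENNReal.ofReal B) (hKt : 4 * K ≤ (n * t : ℕ)) (hA : A.SolvesBA Λ t B) :
    (n - t : ℕ) * K ≤ n * A.messageComplexity Λ t B := by
  by_contra! hM
  have hKB : K ≤ ENNReal.ofReal B := le_self_add.trans hK
  let port : (v : Fin n) → Fin (n - 1) ≃ {u : Fin n // u ≠ v} := fun v =>
    Fintype.equivOfCardEq (by simp [Fintype.card_subtype_compl])
  obtain ⟨g₁, hcard₁, hg₁⟩ := A.exists_measure_confined_pos _
    (A.measure_light_pos (port := port) (input := fun _ => true) hlabel (by omega) hKB hM)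
  obtain ⟨g₀, hcard₀, hg₀⟩ := A.exists_measure_confined_pos _
    (A.measure_light_pos (port := port) (input := fun _ => false) hlabel (by omega) hKB hM)
  have hcard : 2 * (g₁ ∪ g₀).card ≤ n * t := by
    have : ((2 * (g₁.card + g₀.card) : ℕ) : ENNReal) ≤ (n * t : ℕ) :=
      calc ((2 * (g₁.card + g₀.card) : ℕ) : ENNReal) = 2 * (g₁.card + g₀.card) := by push_cast; ring
        _ ≤ 2 * (K + K) := by gcongr
        _ = 4 * K := by ring
        _ ≤ _ := hKt
    exact (Nat.mul_le_mul_left 2 (Finset.card_union_le _ _)).trans (by exact_mod_cast this)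
  obtain ⟨v, byz, rfl, hv, hcontacts⟩ :=
    exists_card_eq_contacts_subset (by omega) port (by omega) _ hcard
  -- A second good node, to disagree with v; this is where t + 2 ≤ n is needed.
  obtain ⟨u, hu⟩ : ∃ u, u ∉ insert v byz := by
    by_contra! h
    have := Finset.card_le_card (fun u _ => h u : Finset.univ ⊆ insert v byz)
    have := Finset.card_insert_le v byz
    simp only [Finset.card_univ, Fintype.card_fin] at *
    omega
  obtain ⟨huv, hu⟩ := not_or.1 (mt Finset.mem_insert.2 hu)
  obtain ⟨η, hη⟩ := exists_frequently_exchange v (A.measurableSet_confined _ K g₁)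
    (A.measurableSet_confined _ K g₀) hg₁ hg₀
    (A.ae_decides_faultFree (port := port) hlabel hKB hA true)
    (A.ae_decides_faultFree (port := port) hlabel hKB hA false)
  obtain ⟨ω, ⟨⟨h₁, hd₁⟩, h₀, hd₀⟩, b, -, hb⟩ :=
    (hη.and_eventually (hA _ (A.admissible_split port label hlabel B byz v η))).exists
  have hview := A.view_split hK hv hcontacts h₁ h₀
  have hbv := (hb v hv).congr fun r => (hview r).1
  have hbu := (hb u hu).congr fun r => (hview r).2 u hu huv
  have := (hbv.unique (hd₁ h₁.1 v hv)).symm.trans (hbu.unique (hd₀ h₀.1 u hu))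
  exact absurd this (by decide)

end Algorithm

theorem ofReal_rpow_le_messageComplexity {ε α : ℝ} (hε0 : 0 < ε) (hε1 : ε < 1) (hα0 : 0 < α)
    (hα1 : α ≤ 1) {n t : ℕ} (hn : 2 / (1 - ε) ≤ n) (ht : (t : ℝ) = ε * n) {L : Type}
    {Λ : Set (Fin n → L)} (hΛ : Λ.Nonempty) (A : Algorithm n L)
    (hA : A.SolvesBA Λ t ((n : ℝ) ^ (1 + α))) :
    ENNReal.ofReal (ε * (1 - ε) / 4 * (n : ℝ) ^ (1 + α / 2)) ≤
      A.messageComplexity Λ t ((n : ℝ) ^ (1 + α)) := by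
  obtain ⟨label, hlabel⟩ := hΛ
  have h1ε : 0 < 1 - ε := by linarith
  rw [div_le_iff₀ h1ε] at hn
  have htn : t + 2 ≤ n := by
    have : (t : ℝ) + 2 ≤ n := by rw [ht]; linarith
    exact_mod_cast this
  have hn1 : (1 : ℝ) ≤ n := by exact_mod_cast (by omega : 1 ≤ n)
  have hpow : 0 < (n : ℝ) ^ (1 + α) := by positivity
  have hsq : (n : ℝ) ^ (1 + α) ≤ n * n := by
    calc (n : ℝ) ^ (1 + α) ≤ (n : ℝ) ^ (2 : ℝ) := Real.rpow_le_rpow_of_exponent_le hn1 (by linarith)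
      _ = n * n := by rw [Real.rpow_two, sq]
  have hhalf : (n : ℝ) ^ (1 + α / 2) ≤ (n : ℝ) ^ (1 + α) :=
    Real.rpow_le_rpow_of_exponent_le hn1 (by linarith)
  -- This K satisfies 2K ≤ n^(1+α), and 4K = ε n^(1+α) ≤ ε n² = nt because α ≤ 1.
  have hkey := A.sub_mul_le_mul_messageComplexity hlabel htn
    (K := ENNReal.ofReal (ε * (n : ℝ) ^ (1 + α) / 4)) (by
      rw [← ENNReal.ofReal_add (by positivity) (by positivity)]
      exact ENNReal.ofReal_le_ofReal (by nlinarith)) (by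
      rw [← ENNReal.ofReal_natCast, ← ENNReal.ofReal_ofNat 4, ← ENNReal.ofReal_mul (by norm_num)]
      refine ENNReal.ofReal_le_ofReal ?_
      push_cast
      rw [ht]
      nlinarith) hA
  have hn0 : (n : ENNReal) ≠ 0 := by exact_mod_cast (by omega : n ≠ 0)
  rw [← ENNReal.mul_le_mul_iff_right hn0 (ENNReal.natCast_ne_top n)]
  refine le_trans ?_ hkey
  rw [← ENNReal.ofReal_natCast n, ← ENNReal.ofReal_natCast (n - t),
    ← ENNReal.ofReal_mul (by positivity), ← ENNReal.ofReal_mul (by positivity)]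
  refine ENNReal.ofReal_le_ofReal ?_
  rw [Nat.cast_sub (by omega), ht]
  -- Only here is the exponent 1 + α weakened to 1 + α/2.
  calc (n : ℝ) * (ε * (1 - ε) / 4 * (n : ℝ) ^ (1 + α / 2))
      ≤ (n : ℝ) * (ε * (1 - ε) / 4 * (n : ℝ) ^ (1 + α)) := by gcongr
    _ = _ := by ring

theorem distinctIDs_nonempty (n : ℕ) {k : ℕ} (hk : 1 ≤ k) : (distinctIDs n k).Nonempty :=
  ⟨fun v => v + 1, fun u v h => Fin.ext (by simpa using h), fun v =>
    ⟨Nat.le_add_left 1 v, le_trans (by omega : v.1 + 1 ≤ n) (Nat.le_self_pow (by omega) n)⟩⟩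
end
theorem mainTheorem4 (ε α : ℝ) (hε0 : 0 < ε) (hε1 : ε < 1) (hα0 : 0 < α) (hα1 : α ≤ 1) :
    ∃ c : ℝ, 0 < c ∧ ∃ n₀ : ℕ, ∀ n : ℕ, n₀ ≤ n → ∀ t : ℕ, (t : ℝ) = ε * n →
      (∀ A : Algorithm n Unit, A.SolvesBA (anonymous n) t ((n : ℝ) ^ (1 + α)) →
        ENNReal.ofReal (c * (n : ℝ) ^ (1 + α / 2)) ≤
          A.messageComplexity (anonymous n) t ((n : ℝ) ^ (1 + α))) ∧
      (∀ k : ℕ, 1 ≤ k → ∀ A : Algorithm n ℕ,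
        A.SolvesBA (distinctIDs n k) t ((n : ℝ) ^ (1 + α)) →
        ENNReal.ofReal (c * (n : ℝ) ^ (1 + α / 2)) ≤
          A.messageComplexity (distinctIDs n k) t ((n : ℝ) ^ (1 + α))) := by
  refine ⟨ε * (1 - ε) / 4, by have : 0 < 1 - ε := by linarith
                              positivity, ⌈2 / (1 - ε)⌉₊, fun n hn t ht => ?_⟩
  exact ⟨ofReal_rpow_le_messageComplexity hε0 hε1 hα0 hα1 (Nat.ceil_le.1 hn) ht Set.univ_nonempty,
    fun k hk => ofReal_rpow_le_messageComplexity hε0 hε1 hα0 hα1 (Nat.ceil_le.1 hn) ht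
      (distinctIDs_nonempty n hk)⟩
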